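/- Super Six for two players is the following game. A lid has six holes; the holes numbered $1,\dots,5$ are shallow and hold at most one stick each, while any stick put into hole $6$ falls through and leaves the game. On each turn the player rolls a fair die at least once. If the hole with the rolled number is free (hole $6$ always is), the player puts a stick from the hand into it, and then may either roll again or stop and hand the die to the opponent; if the hole is occupied, the player takes that stick into the hand and must hand over the die. The first player who has no stick left in hand wins. A situation $(j/k/l)$ means: $j$ sticks stand on the lid, the player deciding (or about to roll) has $k\ge 1$ sticks and the opponent has $l\ge 1$ sticks in hand; $j+k+l$ is the number of sticks in the game. A strategy prescribes, for each situation $(j/k/l)$ that a player reaches by placing a stick, whether to continue rolling or to stop, where on an empty lid ($j=0$) a player always continues. For strategies $S,T$ of players 1 and 2 and a position $A$ (a number of sticks on the lid and in each hand, and the information who has to roll), let $P_A(S,T)$ be the probability that player 1 wins from $A$. A strategy $\hat S$ is optimal for $i$ sticks if $$P_A(T,\hat S)\le P_A(\hat S,\hat S)\le P_A(\hat S,T)$$ for every strategy $T$ and every position $A$ with at most $i$ sticks in the game in which nobody has won yet. For each $i\in\{13,14,15\}$ an optimal strategy for $i$ sticks exists, and every optimal strategy for $i$ sticks decides as follows in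 the situations $(j/k/l)$ with $j+k+l=i$, $1\le j\le 5$ and $k,l\ge 1$: - it continues whenever $j\in\{1,2\}$ and stops whenever $j\in\{4,5\}$; - for $j=3$ and $i=13$ it stops exactly at $(3/4/6)$, $(3/5/5)$ and $(3/6/4)$ and continues otherwise; - for $j=3$ and $i=14$ it stops exactly at $(3/3/8)$, $(3/4/7)$, $(3/5/6)$, $(3/6/5)$, $(3/7/4)$ and $(3/8/3)$ and continues otherwise; - for $j=3$ and $i=15$ it stops exactly at $(3/3/9)$, $(3/4/8)$, $(3/5/7)$, $(3/6/6)$, $(3/7/5)$, $(3/8/4)$ and $(3/9/3)$ and continues otherwise. -/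

import Mathlib

namespace SuperSix

/-- A strategy of a player tells, for each situation `(j/k/l)` reached by placing a stick (`j` sticks
on the lid, `k` in the player's own hand, `l` in the opponent's hand), whether the player keeps
rolling the die (`true`) or stops (`false`). On an empty lid a player always keeps rolling. -/
structure Strategy where
  continues : ℕ → ℕ → ℕ → Bool
  continues_empty : ∀ k l, continues 0 k l = true

/-- A situation of the two-player game just before a roll of the die: whether player 1 is the one
who rolls, the number of sticks standing on the lid, and the sticks in hand of players 1 and 2. -/
structure Position where
  firstRolls : Bool
  lid : ℕ
  hand₁ : ℕ
  hand₂ : ℕ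

/-- The player to roll gets rid of one stick, after which `j` sticks stand on the lid; then this
player keeps the die or hands it over, as told by his strategy
(`S` is the strategy of player 1, `T` that of player 2). -/
def placeStick (S T : Strategy) (p : Position) (j : ℕ) : Position :=
  if p.firstRolls then
    ⟨S.continues j (p.hand₁ - 1) p.hand₂, j, p.hand₁ - 1, p.hand₂⟩
  else
    ⟨!T.continues j (p.hand₂ - 1) p.hand₁, j, p.hand₁, p.hand₂ - 1⟩

/-- The player to roll hits an occupied hole: he takes that stick and hands over the die. -/
def takeStick (p : Position) : Position :=
  if p.firstRolls then ⟨false, p.lid - 1, p.hand₁ + 1, p.hand₂⟩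
  else ⟨true, p.lid - 1, p.hand₁, p.hand₂ + 1⟩

/-- The probability that player 1 wins within `n` rolls of the die from position `p` (with at most
five sticks on the lid), when player 1 plays `S` and player 2 plays `T`. A player wins on running
out of sticks. With `j` sticks on the lid, the fair die shows a six with probability `1/6` (the
stick falls through the lid), the number of a free hole with probability `(5-j)/6`, and the number
of an occupied hole with probability `j/6`. -/
noncomputable def winWithin (S T : Strategy) : ℕ → Position → ℝ
  | 0, p => if p.hand₁ = 0 then 1 else 0
  | n + 1, p =>
    if p.hand₁ = 0 then 1
    else if p.hand₂ = 0 then 0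
    else
      1 / 6 * winWithin S T n (placeStick S T p p.lid)
        + (5 - (p.lid : ℝ)) / 6 * winWithin S T n (placeStick S T p (p.lid + 1))
        + (p.lid : ℝ) / 6 * winWithin S T n (takeStick p)

/-- The probability that player 1 (playing `S` against `T`) wins from position `p`: the limit of the
nondecreasing sequence of the probabilities to win within `n` rolls. -/
noncomputable def winProb (S T : Strategy) (p : Position) : ℝ :=
  ⨆ n, winWithin S T n p

/-- `S` is an optimal strategy of the (symmetric, two-player) game with `i` sticks: in every
position with at most `i` sticks in which nobody has won yet, whoever has to roll, no other strategy
of player 1 has a larger winning probability against `S`, and no strategy of player 2 makes the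
winning probability of `S` smaller than `S` itself does. -/
def IsOptimal (i : ℕ) (S : Strategy) : Prop :=
  ∀ p : Position, p.lid ≤ 5 → 1 ≤ p.hand₁ → 1 ≤ p.hand₂ → p.lid + p.hand₁ + p.hand₂ ≤ i →
    ∀ T : Strategy, winProb T S p ≤ winProb S S p ∧ winProb S S p ≤ winProb S T p

end SuperSix

/-! The game is solved through its optimality equation (`IsValue`): before a roll, the value is the
mean over the die of the values after a best decision. Monotonicity gives a solution `U`
(`exists_isValue`). A maximum principle (`le_of_subharmonic`) gives the rest: a roll removes a stick
from the game with probability 1/6, so the total number of sticks has drift -1/6 and acts as a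
Lyapunov function. It makes `U` unique on the relevant positions, hence symmetric in the players. It
also makes an approximate solution with one-step error `δ` accurate to `6 * δ` per stick.

The strategy `greedy U` secures `U` for either player, so it is optimal. Conversely, any optimal
strategy attains `U` against `greedy U`, so each of its decisions must pick the larger of the two
values of `U` (`IsOptimal.value_continues`).

What remains is to know which value is larger. A table with residual at most one unit of 10⁻⁷ is
within 6 · 15 = 90 units of `U`. The tabulated values of continuing and stopping differ by more than
2 · 90 units in every situation with 13 to 15 sticks, so every decision is forced. -/

open Filter Topology

namespace SuperSix

/-! ### Positions and the optimality equation -/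

/-- The number of sticks in the game. -/
def Position.total (p : Position) : ℕ := p.lid + p.hand₁ + p.hand₂

/-- Nobody has won yet, and the lid holds at most five sticks. -/
structure Position.Live (p : Position) : Prop where
  lid_le : p.lid ≤ 5
  hand₁_pos : 1 ≤ p.hand₁
  hand₂_pos : 1 ≤ p.hand₂

/-- The same position with the roles of the players exchanged. -/
def Position.swap (p : Position) : Position := ⟨!p.firstRolls, p.lid, p.hand₂, p.hand₁⟩

/-- The player to roll gets rid of one stick, leaving `j` sticks on the lid; then player 1 has the
die if and only if `b` holds. -/
def place (b : Bool) (p : Position) (j : ℕ) : Position :=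
  if p.firstRolls then ⟨b, j, p.hand₁ - 1, p.hand₂⟩ else ⟨b, j, p.hand₁, p.hand₂ - 1⟩

/-- The expectation over one roll of the die with `j` sticks on the lid, for the outcomes six, free
hole and occupied hole. -/
noncomputable def rollMean (j : ℕ) (x y z : ℝ) : ℝ :=
  1 / 6 * x + (5 - (j : ℝ)) / 6 * y + (j : ℝ) / 6 * z

/-- The best value of `U` that the player to roll can secure by the decision after placing a stick,
where player 1 maximizes and player 2 minimizes. -/
noncomputable def best (U : Position → ℝ) (p : Position) (j : ℕ) : ℝ :=
  if j = 0 then U (place p.firstRolls p j)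
  else if p.firstRolls then max (U (place true p j)) (U (place false p j))
  else min (U (place true p j)) (U (place false p j))

/-- The expected value of `U` after one roll followed by a best decision. -/
noncomputable def bestRoll (U : Position → ℝ) (p : Position) : ℝ :=
  rollMean p.lid (best U p p.lid) (best U p (p.lid + 1)) (U (takeStick p))

/-- `U` is `1` where player 1 has won and `0` where player 2 has won. -/
structure IsTerminal (U : Position → ℝ) : Prop where
  won : ∀ p, p.lid ≤ 5 → p.hand₁ = 0 → 1 ≤ p.hand₂ → U p = 1
  lost : ∀ p, p.lid ≤ 5 → p.hand₂ = 0 → 1 ≤ p.hand₁ → U p = 0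

/-- `U` solves the optimality equation of the game. -/
structure IsValue (U : Position → ℝ) : Prop where
  won : ∀ p, p.lid ≤ 5 → p.hand₁ = 0 → U p = 1
  lost : ∀ p, p.lid ≤ 5 → p.hand₂ = 0 → 1 ≤ p.hand₁ → U p = 0
  nonneg : ∀ p, 0 ≤ U p
  le_one : ∀ p, U p ≤ 1
  roll : ∀ p, p.Live → U p = bestRoll U p

theorem IsValue.terminal {U : Position → ℝ} (hU : IsValue U) : IsTerminal U :=
  ⟨fun p hp h _ => hU.won p hp h, hU.lost⟩

/-! ### The mean over one roll and the maximum principle -/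

/-- The guards discard outcomes of probability zero: a free hole on a full lid (where six sticks
would stand) and an occupied hole on an empty lid. -/
theorem rollMean_mono {j : ℕ} (hj : j ≤ 5) {x y z x' y' z' : ℝ} (hx : x ≤ x')
    (hy : j + 1 ≤ 5 → y ≤ y') (hz : 1 ≤ j → z ≤ z') : rollMean j x y z ≤ rollMean j x' y' z' := by
  unfold rollMean
  have hj' : (j : ℝ) ≤ 5 := by exact_mod_cast hj
  have h2 : (5 - (j : ℝ)) / 6 * y ≤ (5 - (j : ℝ)) / 6 * y' := by
    rcases hj.eq_or_lt with h | h
    · simp [h]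
    · exact mul_le_mul_of_nonneg_left (hy h) (by linarith)
  have h3 : (j : ℝ) / 6 * z ≤ (j : ℝ) / 6 * z' := by
    rcases Nat.eq_zero_or_pos j with h | h
    · simp [h]
    · exact mul_le_mul_of_nonneg_left (hz h) (by positivity)
  linarith

theorem rollMean_sub (j : ℕ) (x y z x' y' z' : ℝ) :
    rollMean j x y z - rollMean j x' y' z' = rollMean j (x - x') (y - y') (z - z') := by
  unfold rollMean; ring

theorem rollMean_const (j : ℕ) (c : ℝ) : rollMean j c c c = c := by
  unfold rollMean; ring

theorem place_lid (b : Bool) (p : Position) (j : ℕ) : (place b p j).lid = j := by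
  unfold place; split <;> rfl

theorem takeStick_lid (p : Position) : (takeStick p).lid = p.lid - 1 := by
  unfold takeStick; split <;> rfl

theorem place_total {b : Bool} {p : Position} (hp : p.Live) (j : ℕ) :
    (place b p j).total + p.lid + 1 = p.total + j := by
  obtain ⟨h, h1, h2⟩ := hp
  unfold place Position.total
  split <;> dsimp only <;> omega

theorem takeStick_total {p : Position} (h : 1 ≤ p.lid) : (takeStick p).total = p.total := by
  unfold takeStick Position.total
  split <;> dsimp only <;> omega

theorem place_hands {b : Bool} {p : Position} (hp : p.Live) (j : ℕ) :
    1 ≤ (place b p j).hand₁ + (place b p j).hand₂ := by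
  obtain ⟨h, h1, h2⟩ := hp
  unfold place
  split <;> dsimp only <;> omega

theorem takeStick_hands (p : Position) : 1 ≤ (takeStick p).hand₁ + (takeStick p).hand₂ := by
  unfold takeStick
  split <;> dsimp only <;> omega

/-- Maximum principle: each roll lowers the expected number of sticks by `1 / 6`, so a one-step
error `δ` adds up to at most `6 * δ` for each stick in the game. -/
theorem le_of_subharmonic {N : ℕ} {d : Position → ℝ} {δ C : ℝ} (hδ : 0 ≤ δ)
    (hC : ∀ p, p.lid ≤ 5 → d p ≤ C)
    (hwon : ∀ p, p.lid ≤ 5 → p.hand₁ = 0 → 1 ≤ p.hand₂ → d p ≤ 0)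
    (hlost : ∀ p, p.lid ≤ 5 → p.hand₂ = 0 → 1 ≤ p.hand₁ → d p ≤ 0)
    (hstep : ∀ p, p.Live → p.total ≤ N → ∃ b c, d p ≤ rollMean p.lid (d (place b p p.lid))
      (d (place c p (p.lid + 1))) (d (takeStick p)) + δ)
    (p : Position) (hp : p.lid ≤ 5) (hh : 1 ≤ p.hand₁ + p.hand₂) (hN : p.total ≤ N) :
    d p ≤ 6 * δ * p.total := by
  -- Chosen so that `t - 1 / 6 ≤ r * t` for all totals `t ≤ N`; the `N + 1` avoids division by zero.
  set r : ℝ := 1 - 1 / (6 * (N + 1)) with hr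
  have hr0 : 0 ≤ r := by
    rw [hr, sub_nonneg, div_le_one (by positivity)]
    have : (0 : ℝ) ≤ N := by positivity
    linarith
  have hr1 : r < 1 := by
    have : (0 : ℝ) < 1 / (6 * (N + 1)) := by positivity
    linarith
  set K : ℝ := max C 0
  have hK : 0 ≤ K := le_max_right _ _
  have key : ∀ n : ℕ, ∀ q : Position, q.lid ≤ 5 → 1 ≤ q.hand₁ + q.hand₂ → q.total ≤ N →
      d q ≤ (6 * δ + K * r ^ n) * q.total := by
    intro n
    induction n with
    | zero =>
      intro q hq hh hN
      have h1 : (1 : ℝ) ≤ q.total := by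
        have : 1 ≤ q.total := by unfold Position.total; omega
        exact_mod_cast this
      have h2 := (hC q hq).trans (le_max_left C 0)
      change d q ≤ K at h2
      rw [pow_zero, mul_one]
      nlinarith
    | succ n ih =>
      intro q hq hh hN
      have hpos : 0 ≤ (6 * δ + K * r ^ (n + 1)) * (q.total : ℝ) := by positivity
      by_cases h1 : q.hand₁ = 0
      · exact (hwon q hq h1 (by omega)).trans hpos
      by_cases h2 : q.hand₂ = 0
      · exact (hlost q hq h2 (by omega)).trans hpos
      have hl : q.Live := ⟨hq, by omega, by omega⟩
      obtain ⟨b, c, hbc⟩ := hstep q hl hN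
      set M := 6 * δ + K * r ^ n with hM
      have hx : d (place b q q.lid) ≤ M * (q.total - 1) := by
        have ht := place_total (b := b) hl q.lid
        have := ih (place b q q.lid) (by rw [place_lid]; exact hq) (place_hands hl _) (by omega)
        have hc : ((place b q q.lid).total : ℝ) = q.total - 1 := by
          rw [eq_sub_iff_add_eq]
          exact_mod_cast (by omega : (place b q q.lid).total + 1 = q.total)
        rwa [hc] at this
      have hy : q.lid + 1 ≤ 5 → d (place c q (q.lid + 1)) ≤ M * q.total := by
        intro h
        have ht := place_total (b := c) hl (q.lid + 1)
        have := ih (place c q (q.lid + 1)) (by rw [place_lid]; exact h) (place_hands hl _)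
          (by omega)
        rwa [show (place c q (q.lid + 1)).total = q.total by omega] at this
      have hz : 1 ≤ q.lid → d (takeStick q) ≤ M * q.total := by
        intro h
        have := ih (takeStick q) (by rw [takeStick_lid]; omega) (takeStick_hands q)
          (by rw [takeStick_total h]; exact hN)
        rwa [takeStick_total h] at this
      have hm := rollMean_mono hq hx hy hz
      -- Only a six changes the total, so the mean drops by `M / 6`, which is `δ` plus a share of `K
      -- * r ^ n`: the first absorbs the error, the second gives the decay.
      have he : rollMean q.lid (M * (q.total - 1)) (M * q.total) (M * q.total)
          = M * q.total - M / 6 := by unfold rollMean; ring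
      have hN' : (q.total : ℝ) ≤ N + 1 := by exact_mod_cast hN.trans (Nat.le_succ N)
      have hrt : (q.total : ℝ) - 1 / 6 ≤ r * q.total := by
        have : (q.total : ℝ) / (6 * (N + 1)) ≤ 1 / 6 := by
          rw [div_le_div_iff₀ (by positivity) (by norm_num)]
          linarith
        have h' : r * q.total = q.total - q.total / (6 * (N + 1)) := by rw [hr]; ring
        linarith
      have hfin : K * r ^ n * (q.total - 1 / 6) ≤ K * r ^ n * (r * q.total) :=
        mul_le_mul_of_nonneg_left hrt (by positivity)
      calc d q ≤ M * q.total - M / 6 + δ := by linarith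
        _ = 6 * δ * q.total + K * r ^ n * (q.total - 1 / 6) := by rw [hM]; ring
        _ ≤ 6 * δ * q.total + K * r ^ n * (r * q.total) := by linarith
        _ = _ := by rw [pow_succ]; ring
  have hlim : Tendsto (fun n : ℕ => (6 * δ + K * r ^ n) * (p.total : ℝ)) atTop
      (𝓝 ((6 * δ + K * 0) * p.total)) :=
    ((((tendsto_pow_atTop_nhds_zero_of_lt_one hr0 hr1).const_mul K).const_add _).mul_const _)
  have := ge_of_tendsto' hlim fun n => key n p hp hh hN
  simpa using this

/-- A maximizer follows the decision best for `U`, a minimizer the one best for `V`. Thus the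
difference of two solutions is subharmonic for suitable decisions, as the maximum principle
requires. -/
theorem exists_best_sub_le (U V : Position → ℝ) (p : Position) (j : ℕ) :
    ∃ b, best U p j - best V p j ≤ U (place b p j) - V (place b p j) := by
  unfold best
  split_ifs
  · exact ⟨_, le_rfl⟩
  · rcases max_choice (U (place true p j)) (U (place false p j)) with h | h
    · exact ⟨true, by rw [h]; linarith [le_max_left (V (place true p j)) (V (place false p j))]⟩
    · exact ⟨false, by rw [h]; linarith [le_max_right (V (place true p j)) (V (place false p j))]⟩
  · rcases min_choice (V (place true p j)) (V (place false p j)) with h | h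
    · exact ⟨true, by rw [h]; linarith [min_le_left (U (place true p j)) (U (place false p j))]⟩
    · exact ⟨false, by rw [h]; linarith [min_le_right (U (place true p j)) (U (place false p j))]⟩

/-- Approximate solutions of the optimality equation are comparable. -/
theorem sub_le_of_bestRoll {N : ℕ} {U V : Position → ℝ} {δ C : ℝ} (hδ : 0 ≤ δ)
    (hC : ∀ p, p.lid ≤ 5 → U p - V p ≤ C) (hU : IsTerminal U) (hV : IsTerminal V)
    (hstep : ∀ p, p.Live → p.total ≤ N → U p - V p ≤ bestRoll U p - bestRoll V p + δ)
    {p : Position} (hp : p.lid ≤ 5) (hh : 1 ≤ p.hand₁ + p.hand₂) (hN : p.total ≤ N) :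
    U p - V p ≤ 6 * δ * p.total := by
  refine le_of_subharmonic (d := fun q => U q - V q) hδ hC ?_ ?_ ?_ p hp hh hN
  · intro q hq h1 h2
    rw [hU.won q hq h1 h2, hV.won q hq h1 h2, sub_self]
  · intro q hq h1 h2
    rw [hU.lost q hq h1 h2, hV.lost q hq h1 h2, sub_self]
  · intro q hq hN
    obtain ⟨b, hb⟩ := exists_best_sub_le U V q q.lid
    obtain ⟨c, hc⟩ := exists_best_sub_le U V q (q.lid + 1)
    refine ⟨b, c, (hstep q hq hN).trans ?_⟩
    unfold bestRoll
    rw [rollMean_sub]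
    gcongr
    exact rollMean_mono hq.lid_le hb (fun _ => hc) fun _ => le_rfl

/-! ### Exchanging the players -/

/-- The value function seen by the other player. -/
def dual (U : Position → ℝ) (p : Position) : ℝ := 1 - U p.swap

theorem place_swap (b : Bool) (p : Position) (j : ℕ) :
    (place b p j).swap = place (!b) p.swap j := by
  obtain ⟨f, m, k, l⟩ := p
  cases f <;> rfl

theorem takeStick_swap (p : Position) : (takeStick p).swap = takeStick p.swap := by
  obtain ⟨f, m, k, l⟩ := p
  cases f <;> rfl

theorem Position.Live.swap {p : Position} (hp : p.Live) : p.swap.Live :=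
  ⟨hp.lid_le, hp.hand₂_pos, hp.hand₁_pos⟩

theorem Position.total_swap (p : Position) : p.swap.total = p.total := by
  unfold Position.swap Position.total
  dsimp only
  omega

theorem best_dual (U : Position → ℝ) (p : Position) (j : ℕ) :
    best (dual U) p j = 1 - best U p.swap j := by
  obtain ⟨f, m, k, l⟩ := p
  unfold best dual
  simp only [place_swap]
  by_cases hj : j = 0
  · simp [hj, Position.swap]
  · cases f
    · simp only [hj, Position.swap, if_false, Bool.not_true, Bool.not_false, if_true,
        Bool.false_eq_true, min_sub_sub_left]
      rw [max_comm]
    · simp only [hj, Position.swap, if_false, Bool.not_true, Bool.not_false, if_true,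
        Bool.false_eq_true, max_sub_sub_left]
      rw [min_comm]

theorem bestRoll_dual (U : Position → ℝ) (p : Position) :
    bestRoll (dual U) p = 1 - bestRoll U p.swap := by
  unfold bestRoll
  rw [best_dual, best_dual, dual, takeStick_swap, ← rollMean_sub, rollMean_const]
  rfl

/-- With both hands empty a solution is 1 and its dual 0; `IsTerminal` therefore leaves such
positions free. -/
theorem IsTerminal.dual {U : Position → ℝ} (hU : IsTerminal U) : IsTerminal (dual U) where
  won p hp h1 h2 := by simp [SuperSix.dual, hU.lost p.swap hp h1 h2]
  lost p hp h1 h2 := by simp [SuperSix.dual, hU.won p.swap hp h1 h2]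

/-- The value of the game is the same for both players. -/
theorem IsValue.dual_eq {U : Position → ℝ} (hU : IsValue U) {p : Position} (hp : p.lid ≤ 5)
    (hh : 1 ≤ p.hand₁ + p.hand₂) : dual U p = U p := by
  have hroll : ∀ q : Position, q.Live → dual U q = bestRoll (dual U) q := fun q hq => by
    rw [bestRoll_dual, dual, hU.roll _ hq.swap]
  have hd : ∀ q, 0 ≤ dual U q ∧ dual U q ≤ 1 := fun q =>
    ⟨sub_nonneg.2 (hU.le_one _), sub_le_self _ (hU.nonneg _)⟩
  -- Both functions solve the same equation, so comparison in both directions with `δ = 0` is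
  -- uniqueness.
  have h1 := sub_le_of_bestRoll (N := p.total) (U := dual U) (V := U) (C := 1) le_rfl
    (fun q _ => by linarith [(hd q).2, hU.nonneg q]) hU.terminal.dual hU.terminal
    (fun q hq _ => by rw [← hroll q hq, ← hU.roll q hq, add_zero]) hp hh le_rfl
  have h2 := sub_le_of_bestRoll (N := p.total) (U := U) (V := dual U) (C := 1) le_rfl
    (fun q _ => by linarith [(hd q).1, hU.le_one q]) hU.terminal hU.terminal.dual
    (fun q hq _ => by rw [← hroll q hq, ← hU.roll q hq, add_zero]) hp hh le_rfl
  linarith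

/-! ### Existence of a value -/

theorem best_mono {U V : Position → ℝ} (h : ∀ p, U p ≤ V p) (p : Position) (j : ℕ) :
    best U p j ≤ best V p j := by
  obtain ⟨b, hb⟩ := exists_best_sub_le U V p j
  linarith [h (place b p j)]

theorem bestRoll_mono {U V : Position → ℝ} (h : ∀ p, U p ≤ V p) {p : Position} (hp : p.lid ≤ 5) :
    bestRoll U p ≤ bestRoll V p :=
  rollMean_mono hp (best_mono h p _) (fun _ => best_mono h p _) fun _ => h _

theorem bestRoll_const (c : ℝ) (p : Position) : bestRoll (fun _ => c) p = c := by
  have (j : ℕ) : best (fun _ => c) p j = c := by unfold best; simp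
  unfold bestRoll
  rw [this, this, rollMean_const]

/-- Knaster–Tarski: the optimality operator is monotone on the complete lattice of functions from
positions to `[0, 1]`, so its least fixed point is a solution. -/
theorem exists_isValue : ∃ U, IsValue U := by
  classical
  -- Beyond five sticks on the lid the weight of a free hole is negative and monotonicity would
  -- fail, hence the constant there.
  let G (U : Position → ℝ) (p : Position) : ℝ :=
    if 5 < p.lid then 0 else if p.hand₁ = 0 then 1 else if p.hand₂ = 0 then 0 else bestRoll U p
  have hmono : ∀ U V : Position → ℝ, (∀ p, U p ≤ V p) → ∀ p, G U p ≤ G V p := by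
    intro U V h p
    dsimp only [G]
    split_ifs with h0
    · rfl
    · rfl
    · rfl
    · exact bestRoll_mono h (not_lt.1 h0)
  have hmem : ∀ U : Position → ℝ, (∀ p, U p ∈ Set.Icc (0 : ℝ) 1) → ∀ p, G U p ∈ Set.Icc 0 1 := by
    intro U h p
    dsimp only [G]
    split_ifs with h0
    · simp
    · simp
    · simp
    · constructor
      · have := bestRoll_mono (U := fun _ => 0) (fun q => (h q).1) (not_lt.1 h0)
        rwa [bestRoll_const] at this
      · have := bestRoll_mono (V := fun _ => 1) (fun q => (h q).2) (not_lt.1 h0)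
        rwa [bestRoll_const] at this
  let F : (Position → Set.Icc (0 : ℝ) 1) →o (Position → Set.Icc (0 : ℝ) 1) :=
    ⟨fun U p => ⟨G (fun q => U q) p, hmem _ (fun q => (U q).2) p⟩,
      fun U V h p => hmono _ _ (fun q => h q) p⟩
  have hfix : ∀ p, ((F.lfp p : Set.Icc (0 : ℝ) 1) : ℝ) = G (fun q => F.lfp q) p := fun p =>
    congrArg Subtype.val (congrFun F.map_lfp p).symm
  refine ⟨fun q => F.lfp q, fun p hp h1 => ?_, fun p hp h1 h2 => ?_, fun p => (F.lfp p).2.1,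
    fun p => (F.lfp p).2.2, fun p hp => ?_⟩
  · rw [hfix]
    simp [G, h1, hp]
  · rw [hfix]
    exact (if_neg (by omega)).trans ((if_neg (by omega)).trans (if_pos h1))
  · obtain ⟨h0, h1, h2⟩ := hp
    rw [hfix]
    exact (if_neg (by omega)).trans ((if_neg (by omega)).trans (if_neg (by omega)))

/-! ### Winning probabilities of given strategies -/

/-- Whether player 1 has the die after the player to roll has placed a stick. -/
def firstKeeps (S T : Strategy) (p : Position) (j : ℕ) : Bool :=
  if p.firstRolls then S.continues j (p.hand₁ - 1) p.hand₂
  else !T.continues j (p.hand₂ - 1) p.hand₁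

theorem placeStick_eq (S T : Strategy) (p : Position) (j : ℕ) :
    placeStick S T p j = place (firstKeeps S T p j) p j := by
  unfold placeStick place firstKeeps
  split <;> rfl

theorem winWithin_succ (S T : Strategy) (n : ℕ) {p : Position} (hp : p.Live) :
    winWithin S T (n + 1) p = rollMean p.lid (winWithin S T n (placeStick S T p p.lid))
      (winWithin S T n (placeStick S T p (p.lid + 1))) (winWithin S T n (takeStick p)) := by
  have h1 := hp.hand₁_pos
  have h2 := hp.hand₂_pos
  rw [winWithin, if_neg (by omega), if_neg (by omega), rollMean]

theorem winWithin_won (S T : Strategy) (n : ℕ) {p : Position} (h : p.hand₁ = 0) :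
    winWithin S T n p = 1 := by
  cases n <;> simp [winWithin, h]

theorem winWithin_lost (S T : Strategy) (n : ℕ) {p : Position} (h₁ : p.hand₁ ≠ 0)
    (h₂ : p.hand₂ = 0) : winWithin S T n p = 0 := by
  cases n <;> simp [winWithin, h₁, h₂]

theorem placeStick_lid (S T : Strategy) (p : Position) (j : ℕ) :
    (placeStick S T p j).lid = j := by
  rw [placeStick_eq, place_lid]

/-- A function that is at least its mean over the outcomes of each roll bounds the probability to
win. -/
theorem winWithin_le {S T : Strategy} {U : Position → ℝ} (h0 : ∀ p, 0 ≤ U p)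
    (h1 : ∀ p, p.lid ≤ 5 → p.hand₁ = 0 → 1 ≤ U p)
    (hroll : ∀ p, p.Live → rollMean p.lid (U (placeStick S T p p.lid))
      (U (placeStick S T p (p.lid + 1))) (U (takeStick p)) ≤ U p) (n : ℕ) :
    ∀ p : Position, p.lid ≤ 5 → winWithin S T n p ≤ U p := by
  induction n with
  | zero =>
    intro p hp
    rw [winWithin]
    split_ifs with h
    · exact h1 p hp h
    · exact h0 p
  | succ n ih =>
    intro p hp
    by_cases h : p.hand₁ = 0
    · rw [winWithin_won S T _ h]
      exact h1 p hp h
    by_cases h' : p.hand₂ = 0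
    · rw [winWithin_lost S T _ h h']
      exact h0 p
    have hl : p.Live := ⟨hp, by omega, by omega⟩
    rw [winWithin_succ S T n hl]
    refine (rollMean_mono hp (ih _ ?_) (fun h => ih _ ?_) fun h => ih _ ?_).trans (hroll p hl)
    · rwa [placeStick_lid]
    · rwa [placeStick_lid]
    · rw [takeStick_lid]; omega

theorem winWithin_le_one (S T : Strategy) (n : ℕ) {p : Position} (hp : p.lid ≤ 5) :
    winWithin S T n p ≤ 1 :=
  winWithin_le (U := fun _ => 1) (fun _ => zero_le_one) (fun _ _ _ => le_rfl)
    (fun _ _ => (rollMean_const _ _).le) n p hp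

theorem winWithin_nonneg (S T : Strategy) (n : ℕ) :
    ∀ p : Position, p.lid ≤ 5 → 0 ≤ winWithin S T n p := by
  induction n with
  | zero =>
    intro p _
    rw [winWithin]
    split_ifs <;> norm_num
  | succ n ih =>
    intro p hp
    by_cases h : p.hand₁ = 0
    · rw [winWithin_won S T _ h]
      exact zero_le_one
    by_cases h' : p.hand₂ = 0
    · rw [winWithin_lost S T _ h h']
    rw [winWithin_succ S T n ⟨hp, by omega, by omega⟩, ← rollMean_const p.lid 0]
    refine rollMean_mono hp (ih _ ?_) (fun h => ih _ ?_) fun h => ih _ ?_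
    · rwa [placeStick_lid]
    · rwa [placeStick_lid]
    · rw [takeStick_lid]; omega

theorem winWithin_le_succ (S T : Strategy) (n : ℕ) :
    ∀ p : Position, p.lid ≤ 5 → winWithin S T n p ≤ winWithin S T (n + 1) p := by
  induction n with
  | zero =>
    intro p hp
    by_cases h : p.hand₁ = 0
    · rw [winWithin_won S T _ h, winWithin_won S T _ h]
    · rw [winWithin, if_neg h]
      exact winWithin_nonneg S T _ p hp
  | succ n ih =>
    intro p hp
    by_cases h : p.hand₁ = 0
    · rw [winWithin_won S T _ h, winWithin_won S T _ h]
    by_cases h' : p.hand₂ = 0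
    · rw [winWithin_lost S T _ h h', winWithin_lost S T _ h h']
    have hl : p.Live := ⟨hp, by omega, by omega⟩
    rw [winWithin_succ S T n hl, winWithin_succ S T (n + 1) hl]
    refine rollMean_mono hp (ih _ ?_) (fun h => ih _ ?_) fun h => ih _ ?_
    · rwa [placeStick_lid]
    · rwa [placeStick_lid]
    · rw [takeStick_lid]; omega

theorem tendsto_winWithin (S T : Strategy) {p : Position} (hp : p.lid ≤ 5) :
    Tendsto (fun n => winWithin S T n p) atTop (𝓝 (winProb S T p)) :=
  tendsto_atTop_ciSup (monotone_nat_of_le_succ fun n => winWithin_le_succ S T n p hp)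
    ⟨1, by rintro _ ⟨n, rfl⟩; exact winWithin_le_one S T n hp⟩

theorem winProb_nonneg (S T : Strategy) {p : Position} (hp : p.lid ≤ 5) : 0 ≤ winProb S T p :=
  ge_of_tendsto' (tendsto_winWithin S T hp) fun n => winWithin_nonneg S T n p hp

theorem winProb_roll (S T : Strategy) {p : Position} (hp : p.Live) :
    winProb S T p = rollMean p.lid (winProb S T (placeStick S T p p.lid))
      (winProb S T (placeStick S T p (p.lid + 1))) (winProb S T (takeStick p)) := by
  refine tendsto_nhds_unique
    ((tendsto_add_atTop_iff_nat 1).2 (tendsto_winWithin S T hp.lid_le)) ?_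
  simp only [winWithin_succ S T _ hp, rollMean]
  refine ((Tendsto.const_mul _ (tendsto_winWithin S T ?_)).add ?_).add
    (Tendsto.const_mul _ (tendsto_winWithin S T ?_))
  · rw [placeStick_lid]
    exact hp.lid_le
  · rcases hp.lid_le.eq_or_lt with h | h
    · simp [h]
    · exact Tendsto.const_mul _ (tendsto_winWithin S T (by rwa [placeStick_lid]))
  · rw [takeStick_lid]
    have := hp.lid_le
    omega

theorem winProb_isTerminal (S T : Strategy) : IsTerminal (winProb S T) where
  won p _ h _ := by simp [winProb, winWithin_won S T _ h]
  lost p _ h h' := by simp [winProb, winWithin_lost S T _ (by omega : p.hand₁ ≠ 0) h]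

/-! ### The greedy strategy -/

theorem le_best (U : Position → ℝ) (S T : Strategy) {p : Position} (h : p.firstRolls = true)
    (j : ℕ) : U (placeStick S T p j) ≤ best U p j := by
  rw [placeStick_eq]
  unfold best firstKeeps
  by_cases hj : j = 0
  · simp [hj, h, S.continues_empty]
  · simp only [hj, h, if_true, if_false]
    cases S.continues j (p.hand₁ - 1) p.hand₂
    · exact le_max_right _ _
    · exact le_max_left _ _

theorem best_le (U : Position → ℝ) (S T : Strategy) {p : Position} (h : p.firstRolls = false)
    (j : ℕ) : best U p j ≤ U (placeStick S T p j) := by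
  rw [placeStick_eq]
  unfold best firstKeeps
  by_cases hj : j = 0
  · simp [hj, h, T.continues_empty]
  · simp only [hj, h, if_false, Bool.false_eq_true]
    cases T.continues j (p.hand₂ - 1) p.hand₁
    · exact min_le_left _ _
    · exact min_le_right _ _

open Classical in
/-- The strategy that keeps rolling whenever this is at least as good as stopping. -/
noncomputable def greedy (U : Position → ℝ) : Strategy where
  continues j k l := decide (j = 0 ∨ U ⟨false, j, k, l⟩ ≤ U ⟨true, j, k, l⟩)
  continues_empty k l := by simp

theorem best_eq_greedy_first (U : Position → ℝ) (T : Strategy) {p : Position}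
    (h : p.firstRolls = true) (j : ℕ) : U (placeStick (greedy U) T p j) = best U p j := by
  obtain ⟨f, m, k, l⟩ := p
  obtain rfl : f = true := h
  rw [placeStick_eq]
  unfold best firstKeeps greedy
  by_cases hj : j = 0
  · simp [hj]
  · simp only [hj, if_true, if_false, false_or, place]
    by_cases hU : U ⟨false, j, k - 1, l⟩ ≤ U ⟨true, j, k - 1, l⟩
    · simp [hU]
    · simp [hU, (not_le.1 hU).le]

/-- Player 2 consults `U` with the roles exchanged; the symmetry `IsValue.dual_eq` turns that
comparison into the minimum in `best`. -/
theorem best_eq_greedy_second {U : Position → ℝ} (hU : IsValue U) (T : Strategy) {p : Position}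
    (hp : p.Live) (h : p.firstRolls = false) {j : ℕ} (hj5 : j ≤ 5) :
    U (placeStick T (greedy U) p j) = best U p j := by
  obtain ⟨f, m, k, l⟩ := p
  obtain rfl : f = false := h
  have hk : 1 ≤ k := hp.hand₁_pos
  have e1 := hU.dual_eq (p := ⟨false, j, l - 1, k⟩) hj5 (by dsimp only; omega)
  have e2 := hU.dual_eq (p := ⟨true, j, l - 1, k⟩) hj5 (by dsimp only; omega)
  simp only [dual, Position.swap, Bool.not_false, Bool.not_true] at e1 e2
  rw [placeStick_eq]
  unfold best firstKeeps greedy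
  by_cases hj : j = 0
  · simp [hj]
  · simp only [hj, if_false, false_or, place, Bool.false_eq_true]
    by_cases hc : U ⟨false, j, l - 1, k⟩ ≤ U ⟨true, j, l - 1, k⟩
    · have : U ⟨false, j, k, l - 1⟩ ≤ U ⟨true, j, k, l - 1⟩ := by linarith
      simp [hc, this]
    · have : U ⟨true, j, k, l - 1⟩ ≤ U ⟨false, j, k, l - 1⟩ := by linarith
      simp [hc, this]

theorem winProb_le_value {U : Position → ℝ} (hU : IsValue U) (T : Strategy) {p : Position}
    (hp : p.lid ≤ 5) : winProb T (greedy U) p ≤ U p := by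
  refine le_of_tendsto' (tendsto_winWithin T (greedy U) hp) fun n =>
    winWithin_le hU.nonneg (fun q hq h => (hU.won q hq h).ge) (fun q hq => ?_) n p hp
  rw [hU.roll q hq]
  have key : ∀ j ≤ 5, U (placeStick T (greedy U) q j) ≤ best U q j := by
    intro j hj
    cases h : q.firstRolls
    · exact (best_eq_greedy_second hU T hq h hj).le
    · exact le_best U T (greedy U) h j
  exact rollMean_mono hq.lid_le (key _ hq.lid_le) (key _) fun _ => le_rfl

/-- Unlike the upper bound, this cannot come from induction on the number of rolls, since unfinished
play counts as not won by player 1. The maximum principle, applied to `U - W`, supplies the missing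
termination. -/
theorem value_le_winProb {U : Position → ℝ} (hU : IsValue U) (T : Strategy) {p : Position}
    (hp : p.Live) : U p ≤ winProb (greedy U) T p := by
  set W := winProb (greedy U) T with hW
  have hter : IsTerminal W := winProb_isTerminal _ _
  have h := le_of_subharmonic (N := p.total) (d := fun q => U q - W q) (δ := 0) (C := 1) le_rfl
    (fun q hq => by linarith [hU.le_one q, winProb_nonneg (greedy U) T hq])
    (fun q hq h1 h2 => by rw [hU.won q hq h1, hter.won q hq h1 h2, sub_self])
    (fun q hq h1 h2 => by rw [hU.lost q hq h1 h2, hter.lost q hq h1 h2, sub_self])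
    (fun q hq _ => ?_) p hp.lid_le (by have := hp.hand₁_pos; omega) le_rfl
  · simpa using h
  · have key : ∀ j, best U q j ≤ U (placeStick (greedy U) T q j) := by
      intro j
      cases h : q.firstRolls
      · exact best_le U (greedy U) T h j
      · exact (best_eq_greedy_first U T h j).ge
    refine ⟨firstKeeps (greedy U) T q q.lid, firstKeeps (greedy U) T q (q.lid + 1), ?_⟩
    rw [hU.roll q hq, hW, winProb_roll (greedy U) T hq, bestRoll, rollMean_sub, add_zero,
      ← placeStick_eq, ← placeStick_eq]
    exact rollMean_mono hq.lid_le (sub_le_sub_right (key _) _)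
      (fun _ => sub_le_sub_right (key _) _) fun _ => le_rfl

/-- The greedy strategy is optimal for every number of sticks. -/
theorem greedy_isOptimal {U : Position → ℝ} (hU : IsValue U) (i : ℕ) :
    IsOptimal i (greedy U) := by
  intro p hp h1 h2 _ T
  have hl : p.Live := ⟨hp, h1, h2⟩
  exact ⟨(winProb_le_value hU T hp).trans (value_le_winProb hU _ hl),
    (winProb_le_value hU _ hp).trans (value_le_winProb hU T hl)⟩

/-! ### Decisions of an arbitrary optimal strategy -/

/-- With `G` for `greedy U`, `U` is at most the value of `G` against `S`, then by optimality of `S`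
at most that of `S` against `S` and of `S` against `G`, which is at most `U`. -/
theorem IsOptimal.winProb_greedy {U : Position → ℝ} (hU : IsValue U) {i : ℕ} {S : Strategy}
    (hS : IsOptimal i S) {p : Position} (hp : p.Live) (hi : p.total ≤ i) :
    winProb S (greedy U) p = U p := by
  obtain ⟨h, h'⟩ := hS p hp.lid_le hp.hand₁_pos hp.hand₂_pos hi (greedy U)
  exact le_antisymm (winProb_le_value hU S hp.lid_le)
    ((value_le_winProb hU S hp).trans (h.trans h'))

/-- The decisions of an optimal strategy attain the maximum in the optimality equation. -/
theorem IsOptimal.value_continues {U : Position → ℝ} (hU : IsValue U) {i : ℕ} {S : Strategy}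
    (hS : IsOptimal i S) {j k l : ℕ} (hj : 1 ≤ j) (hj5 : j ≤ 5) (hl : 1 ≤ l)
    (hi : j + k + l ≤ i) (b : Bool) :
    U ⟨b, j, k, l⟩ ≤ U ⟨S.continues j k l, j, k, l⟩ := by
  obtain ⟨m, rfl⟩ := Nat.exists_eq_add_of_le' hj
  -- A predecessor from which filling a free hole leads to the situation. It has the same total, so
  -- optimality for `i` sticks applies.
  set p : Position := ⟨true, m, k + 1, l⟩ with hp
  have hlive : p.Live := ⟨by dsimp only [p]; omega, by dsimp only [p]; omega, hl⟩
  have h1 := hS.winProb_greedy hU hlive (by dsimp only [p, Position.total]; omega)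
  rw [winProb_roll S (greedy U) hlive, hU.roll p hlive, bestRoll] at h1
  have hm : (m : ℝ) + 1 ≤ 5 := by exact_mod_cast hj5
  have hx : winProb S (greedy U) (placeStick S (greedy U) p m) ≤ best U p m :=
    (winProb_le_value hU S (by rw [placeStick_lid]; omega)).trans (le_best U S _ rfl _)
  have hy : winProb S (greedy U) (placeStick S (greedy U) p (m + 1))
      ≤ U (placeStick S (greedy U) p (m + 1)) :=
    winProb_le_value hU S (by rw [placeStick_lid]; omega)
  have hz : winProb S (greedy U) (takeStick p) ≤ U (takeStick p) :=
    winProb_le_value hU S (by rw [takeStick_lid]; dsimp only [p]; omega)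
  have hb : U ⟨b, m + 1, k, l⟩ ≤ best U p (m + 1) := by
    have e : ∀ c, place c p (m + 1) = ⟨c, m + 1, k, l⟩ := fun c => by simp [place, p]
    have : best U p (m + 1) = max (U ⟨true, m + 1, k, l⟩) (U ⟨false, m + 1, k, l⟩) := by
      rw [best, if_neg (Nat.succ_ne_zero m), if_pos rfl, e, e]
    rw [this]
    cases b
    · exact le_max_right _ _
    · exact le_max_left _ _
  have hpl : placeStick S (greedy U) p (m + 1) = ⟨S.continues (m + 1) k l, m + 1, k, l⟩ := by
    simp [placeStick, p]
  rw [hpl] at hy h1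
  -- A worse decision costs strictly at the free-hole outcome, whose probability `(5 - m) / 6` is
  -- positive, and no other outcome compensates.
  by_contra! hlt
  have h2 : rollMean m (winProb S (greedy U) (placeStick S (greedy U) p m))
      (winProb S (greedy U) ⟨S.continues (m + 1) k l, m + 1, k, l⟩)
      (winProb S (greedy U) (takeStick p))
      < rollMean m (best U p m) (best U p (m + 1)) (U (takeStick p)) := by
    unfold rollMean
    have h3 := mul_le_mul_of_nonneg_left hz (by positivity : (0 : ℝ) ≤ (m : ℝ) / 6)
    have h4 := mul_lt_mul_of_pos_left (hy.trans_lt (hlt.trans_le hb))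
      (by linarith : (0 : ℝ) < (5 - (m : ℝ)) / 6)
    linarith
  exact h2.ne h1

/-! ### The numerical certificate -/

/-- The value of the game for the player to roll at `(j/k/l)` with at most 15 sticks, in units of
`10⁻⁷` and rounded, listed by `j`, then `k`, then `l`. -/
def valueTable : List (List (List ℕ)) :=
  [[[10000000, 10000000, 10000000, 10000000, 10000000, 10000000, 10000000, 10000000, 10000000,
     10000000, 10000000, 10000000, 10000000, 10000000],
    [8611111, 8780488, 9015160, 9249223, 9443000, 9583170, 9680563, 9748737, 9797800, 9834230,
     9862052, 9883795, 9901108],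
    [6567299, 7090849, 7668089, 8188487, 8598968, 8902728, 9124483, 9288519, 9412580, 9508562,
     9584225, 9644887],
    [4532731, 5405594, 6265877, 7006486, 7596076, 8048829, 8395147, 8663103, 8873783, 9041870,
     9177971],
    [2929436, 4010403, 5018188, 5880847, 6587223, 7151336, 7600643, 7961211, 8253407, 8493001],
    [1897444, 3001178, 4020359, 4917525, 5678002, 6308490, 6828638, 7259519, 7618571],
    [1296728, 2299949, 3255836, 4129760, 4897451, 5556340, 6117598, 6595339],
    [942401, 1809095, 2672715, 3493059, 4238586, 4898874, 5476840],
    [719443, 1455839, 2222695, 2977155, 3684407, 4327547],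
    [568866, 1193545, 1869624, 2556387, 3216573],
    [461152, 993226, 1588686, 2209559],
    [380754, 836675, 1361805],
    [318857, 712019],
    [270088]],
   [[8333333, 8536585, 8818192, 9099068, 9331600, 9499804, 9616675, 9698484, 9757360, 9801076,
     9834462, 9860554, 9881330],
    [6158537, 6752922, 7398674, 7976340, 8430161, 8766640, 9013268, 9196475, 9335536, 9443428,
     9528659, 9597105],
    [4125817, 5068543, 5985434, 6770085, 7395498, 7878049, 8249280, 8538020, 8766024, 8948532,
     9096721],
    [2608777, 3731365, 4768650, 5655719, 6385452, 6971837, 7441742, 7820833, 8129331, 8383227],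
    [1691046, 2799332, 3820793, 4724860, 5496158, 6139921, 6674237, 7119180, 7491603],
    [1176585, 2159704, 3102932, 3972207, 4741341, 5405910, 5975390, 6462503],
    [871535, 1710925, 2556091, 3365719, 4106813, 4767381, 5348688],
    [674851, 1385188, 2132691, 2873975, 3573571, 4213281],
    [538750, 1141086, 1799010, 2472233, 3123006],
    [439610, 953163, 1532499, 2140193],
    [364674, 805365, 1316428],
    [306477, 687088],
    [260334]],
   [[7154472, 7749026, 8310486, 8756212, 9066889, 9280099, 9429692, 9538271, 9619638, 9682279,
     9731545, 9770971],
    [4649091, 5726890, 6675604, 7412664, 7955918, 8354795, 8653043, 8881176, 9059440, 9201037,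
     9315306],
    [2881711, 4190661, 5306359, 6190077, 6876109, 7407744, 7824656, 8156390, 8423593, 8641851],
    [1884375, 3161950, 4264709, 5185568, 5935709, 6544044, 7040005, 7448280, 7786959],
    [1342115, 2459863, 3480320, 4375883, 5138132, 5781044, 6323926, 6783169],
    [1013157, 1963645, 2880533, 3721302, 4465187, 5114473, 5678019],
    [794393, 1599501, 2413159, 3187978, 3897006, 4532719],
    [639412, 1323889, 2042482, 2750324, 3414366],
    [524727, 1109986, 1745052, 2386725],
    [437109, 940705, 1502739],
    [368547, 804568],
    [313882]],
   [[6125487, 7136555, 7904670, 8419025, 8770069, 9018177, 9200250, 9338055, 9445007, 9529647,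
     9597716],
    [3613104, 5123251, 6234240, 7013078, 7583485, 8012028, 8342110, 8601705, 8808862, 8976818],
    [2362578, 3880454, 5024297, 5898078, 6576820, 7113068, 7542999, 7891702, 8178391],
    [1722642, 3043502, 4124437, 5004468, 5724308, 6317257, 6809124, 7221174],
    [1323391, 2449514, 3433812, 4278472, 4999512, 5614931, 6142534],
    [1050056, 2008770, 2891487, 3681986, 4381141, 4997717],
    [852267, 1671635, 2457927, 3187230, 3852812],
    [703700, 1407627, 2106522, 2774235],
    [588950, 1197188, 1818609],
    [498428, 1026972],
    [425802]],
   [[5242297, 6584499, 7413031, 7970998, 8366990, 8660820, 8885576, 9061582, 9201875, 9315352],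
    [3185117, 4801267, 5875843, 6641016, 7218881, 7667715, 8023776, 8310694, 8544719],
    [2290076, 3759113, 4824674, 5649165, 6305462, 6837378, 7274009, 7635545],
    [1773215, 3033954, 4032073, 4850752, 5533270, 6107261, 6592295],
    [1414098, 2497459, 3408287, 4192052, 4870932, 5459346],
    [1152205, 2084858, 2906983, 3642503, 4299249],
    [954057, 1760091, 2498620, 3179705],
    [800190, 1500260, 2161667],
    [678341, 1289170],
    [580262]],
   [[4512917, 5998944, 6867406, 7471705, 7918784, 8262619, 8533258, 8749784, 8925692],
    [3070322, 4591744, 5586492, 6326116, 6903533, 7364921, 7739220, 8047017],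
    [2357677, 3700529, 4675607, 5448843, 6080643, 6604092, 7042423],
    [1882940, 3053184, 3966181, 4727912, 5375216, 5929812],
    [1537366, 2555885, 3394045, 4122630, 4763440],
    [1275556, 2162931, 2924885, 3610552],
    [1071579, 1846935, 2536364],
    [909561, 1589531],
    [778909]]]

/-- The approximate value for the player to roll at `(j/k/l)`, in units of `10⁻⁷`. -/
def approx (j k l : ℕ) : ℤ :=
  (((valueTable.getD j []).getD (k - 1) []).getD (l - 1) 0 : ℕ)

/-- The approximate value at `(j/k/l)` for the player who has just placed a stick, in units of
`10⁻⁷`. -/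
def approxDecide (j k l : ℕ) : ℤ :=
  if k = 0 then 10000000 else if j = 0 then approx j k l
  else max (approx j k l) (10000000 - approx j l k)

/-- The equation is multiplied by 6 to stay in the integers, so the bound 6 means one unit of 10⁻⁷.
The out-of-range entries at `j = 0` and `j = 5` have coefficient zero. -/
theorem approx_residual : ∀ j < 6, ∀ k < 15, ∀ l < 15, 1 ≤ k ∧ 1 ≤ l ∧ j + k + l ≤ 15 →
    |6 * approx j k l - (approxDecide j (k - 1) l + (5 - j) * approxDecide (j + 1) (k - 1) l
      + j * (10000000 - approx (j - 1) l (k + 1)))| ≤ 6 := by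
  decide +kernel

/-- The situations with 13, 14 or 15 sticks in which an optimal strategy stops. -/
def Stops (j k l : ℕ) : Prop :=
  j = 4 ∨ j = 5 ∨ (j = 3 ∧ 4 ≤ k ∧ 4 ≤ l) ∨ (j = 3 ∧ 14 ≤ j + k + l ∧ 3 ≤ k ∧ 3 ≤ l)

instance (j k l : ℕ) : Decidable (Stops j k l) := by
  unfold Stops
  infer_instance

set_option synthInstance.maxSize 1024 in
-- The margin 180 is twice the error bound 90, one for each of the two values compared.
theorem approx_gap : ∀ j < 6, ∀ k < 15, ∀ l < 15, 1 ≤ j ∧ 1 ≤ k ∧ 1 ≤ l ∧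
    13 ≤ j + k + l ∧ j + k + l ≤ 15 →
    (Stops j k l → approx j k l + 180 < 10000000 - approx j l k) ∧
    (¬ Stops j k l → 10000000 - approx j l k + 180 < approx j k l) := by
  decide +kernel

/-- The approximate probability that player 1 wins. -/
noncomputable def approxValue (p : Position) : ℝ :=
  if p.hand₁ = 0 then 1 else if p.hand₂ = 0 then 0
  else if p.firstRolls then approx p.lid p.hand₁ p.hand₂ / 10000000
  else 1 - approx p.lid p.hand₂ p.hand₁ / 10000000

theorem approxValue_isTerminal : IsTerminal approxValue where
  won p _ h _ := by simp [approxValue, h]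
  lost p _ h h' := by simp [approxValue, h, Nat.one_le_iff_ne_zero.1 h']

theorem approxValue_swap {p : Position} (hh : 1 ≤ p.hand₁ + p.hand₂) :
    approxValue p.swap = 1 - approxValue p := by
  obtain ⟨f, j, k, l⟩ := p
  rcases Nat.eq_zero_or_pos k with rfl | hk
  · have : l ≠ 0 := by dsimp only at hh; omega
    simp [approxValue, Position.swap, this]
  · rcases Nat.eq_zero_or_pos l with rfl | hl
    · simp [approxValue, Position.swap, hk.ne']
    · cases f <;> simp [approxValue, Position.swap, hk.ne', hl.ne']

theorem best_approxValue (m k l j : ℕ) (hl : 1 ≤ l) :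
    best approxValue ⟨true, m, k + 1, l⟩ j = approxDecide j k l / 10000000 := by
  have hl' : l ≠ 0 := by omega
  unfold best approxDecide
  simp only [place, if_true, Nat.add_sub_cancel]
  by_cases hk : k = 0
  · simp [approxValue, hk]
  by_cases hj : j = 0
  · simp [approxValue, hk, hj, hl']
  simp only [approxValue, hk, hj, hl', if_false, if_true, Bool.false_eq_true]
  push_cast
  rw [← max_div_div_right (by norm_num), sub_div, div_self (by norm_num)]

/-- Needed because `approxValue_swap` fails when both hands are empty; no roll from a live position
leads there. -/
theorem bestRoll_congr {U V : Position → ℝ}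
    (h : ∀ p : Position, 1 ≤ p.hand₁ + p.hand₂ → U p = V p) {p : Position} (hp : p.Live) :
    bestRoll U p = bestRoll V p := by
  have hb (j : ℕ) : best U p j = best V p j := by
    unfold best
    simp only [h _ (place_hands hp j)]
  rw [bestRoll, bestRoll, hb, hb, h _ (takeStick_hands p)]

theorem abs_approxValue_sub_bestRoll_first {j k l : ℕ} (hj : j ≤ 5) (hl : 1 ≤ l)
    (hi : j + (k + 1) + l ≤ 15) :
    |approxValue ⟨true, j, k + 1, l⟩ - bestRoll approxValue ⟨true, j, k + 1, l⟩|
      ≤ 1 / 10000000 := by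
  have h := approx_residual j (by omega) (k + 1) (by omega) l (by omega) ⟨by omega, hl, hi⟩
  have hl' : l ≠ 0 := by omega
  have ht : approxValue (takeStick ⟨true, j, k + 1, l⟩)
      = 1 - approx (j - 1) l (k + 1 + 1) / 10000000 := by
    simp [approxValue, takeStick, hl']
  have ha : approxValue ⟨true, j, k + 1, l⟩ = approx j (k + 1) l / 10000000 := by
    simp [approxValue, hl']
  rw [bestRoll, best_approxValue _ _ _ _ hl, best_approxValue _ _ _ _ hl, ht, ha, rollMean]
  rw [Nat.add_sub_cancel] at h
  have h' : |6 * (approx j (k + 1) l : ℝ) - (approxDecide j k l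
      + (5 - j) * approxDecide (j + 1) k l
      + j * (10000000 - approx (j - 1) l (k + 1 + 1)))| ≤ 6 := by exact_mod_cast h
  rw [abs_le] at h' ⊢
  constructor <;> linarith [h'.1, h'.2]

theorem abs_approxValue_sub_bestRoll {p : Position} (hp : p.Live) (hi : p.total ≤ 15) :
    |approxValue p - bestRoll approxValue p| ≤ 1 / 10000000 := by
  have first : ∀ q : Position, q.Live → q.total ≤ 15 → q.firstRolls = true →
      |approxValue q - bestRoll approxValue q| ≤ 1 / 10000000 := by
    rintro ⟨f, j, k, l⟩ ⟨h0, h1, h2⟩ hi hf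
    obtain rfl : f = true := hf
    obtain ⟨k, rfl⟩ := Nat.exists_eq_add_of_le' h1
    exact abs_approxValue_sub_bestRoll_first h0 h2 hi
  cases hf : p.firstRolls
  · have h := first p.swap hp.swap (by rwa [Position.total_swap]) (by simp [Position.swap, hf])
    have hd : bestRoll approxValue p = 1 - bestRoll approxValue p.swap := by
      rw [← bestRoll_dual]
      refine bestRoll_congr (fun q hq => ?_) hp
      rw [dual, approxValue_swap hq, sub_sub_cancel]
    rw [approxValue_swap (by have := hp.hand₁_pos; omega)] at h
    rw [hd, ← abs_neg]
    convert h using 2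
    ring
  · exact first p hp hi hf

theorem getD_of_forall_mem {α : Type*} {P : α → Prop} {L : List α} {d : α} (hd : P d)
    (hL : ∀ x ∈ L, P x) (n : ℕ) : P (L.getD n d) := by
  rcases lt_or_ge n L.length with h | h
  · rw [List.getD_eq_getElem _ _ h]
    exact hL _ (List.getElem_mem h)
  · rwa [List.getD_eq_default _ _ h]

theorem approx_le (j k l : ℕ) : approx j k l ≤ 10000000 := by
  have hT : ∀ A ∈ valueTable, ∀ B ∈ A, ∀ x ∈ B, x ≤ 10000000 := by decide +kernel
  have hA := getD_of_forall_mem (P := fun A => ∀ B ∈ A, ∀ x ∈ B, x ≤ 10000000) (d := [])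
    (by simp) hT j
  have hB := getD_of_forall_mem (P := fun B => ∀ x ∈ B, x ≤ 10000000) (d := []) (by simp) hA (k - 1)
  unfold approx
  exact_mod_cast getD_of_forall_mem (P := fun x => x ≤ 10000000) (d := 0) (by simp) hB (l - 1)

theorem approx_div_mem (j k l : ℕ) : (approx j k l : ℝ) / 10000000 ∈ Set.Icc (0 : ℝ) 1 := by
  have h0 : (0 : ℝ) ≤ approx j k l := by
    rw [approx]
    positivity
  have h1 : (approx j k l : ℝ) ≤ 10000000 := by exact_mod_cast approx_le j k l
  exact ⟨by positivity, by rw [div_le_one (by norm_num)]; exact h1⟩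

theorem approxValue_mem (p : Position) : approxValue p ∈ Set.Icc (0 : ℝ) 1 := by
  have h1 := approx_div_mem p.lid p.hand₁ p.hand₂
  have h2 := approx_div_mem p.lid p.hand₂ p.hand₁
  unfold approxValue
  split_ifs
  · simp
  · simp
  · exact h1
  · exact ⟨sub_nonneg.2 h2.2, sub_le_self _ h2.1⟩

/-- Here 90 is `6 * δ * total` with `δ` one unit and at most 15 sticks. -/
theorem IsValue.abs_sub_approxValue_le {U : Position → ℝ} (hU : IsValue U) {p : Position}
    (hp : p.lid ≤ 5) (hh : 1 ≤ p.hand₁ + p.hand₂) (hi : p.total ≤ 15) :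
    |U p - approxValue p| ≤ 90 / 10000000 := by
  have ht : (p.total : ℝ) ≤ 15 := by exact_mod_cast hi
  have hres (q : Position) (hq : q.Live) (hi : q.total ≤ 15) :=
    abs_le.1 (abs_approxValue_sub_bestRoll hq hi)
  have h1 := sub_le_of_bestRoll (N := 15) (U := U) (V := approxValue) (δ := 1 / 10000000) (C := 1)
    (by norm_num) (fun q _ => by linarith [hU.le_one q, (approxValue_mem q).1]) hU.terminal
    approxValue_isTerminal
    (fun q hq hi => by linarith [hU.roll q hq, (hres q hq hi).1]) hp hh hi
  have h2 := sub_le_of_bestRoll (N := 15) (U := approxValue) (V := U) (δ := 1 / 10000000) (C := 1)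
    (by norm_num) (fun q _ => by linarith [hU.nonneg q, (approxValue_mem q).2]) approxValue_isTerminal
    hU.terminal
    (fun q hq hi => by linarith [hU.roll q hq, (hres q hq hi).2]) hp hh hi
  rw [abs_le]
  constructor <;> linarith

/-! ### Forced decisions -/

theorem IsOptimal.continues_eq_false_iff {i : ℕ} {S : Strategy} (hS : IsOptimal i S)
    {j k l : ℕ} (hj : 1 ≤ j) (hj5 : j ≤ 5) (hk : 1 ≤ k) (hl : 1 ≤ l) (hi : j + k + l = i)
    (hi13 : 13 ≤ i) (hi15 : i ≤ 15) : S.continues j k l = false ↔ Stops j k l := by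
  obtain ⟨U, hU⟩ := exists_isValue
  have hgap := approx_gap j (by omega) k (by omega) l (by omega)
    ⟨hj, hk, hl, by omega, by omega⟩
  have hh : 1 ≤ k + l := by omega
  have ht : j + k + l ≤ 15 := by omega
  have h1 := abs_le.1 (hU.abs_sub_approxValue_le (p := ⟨true, j, k, l⟩) hj5 hh ht)
  have h2 := abs_le.1 (hU.abs_sub_approxValue_le (p := ⟨false, j, k, l⟩) hj5 hh ht)
  simp only [approxValue, Nat.one_le_iff_ne_zero.1 hk, Nat.one_le_iff_ne_zero.1 hl, if_false,
    if_true, Bool.false_eq_true] at h1 h2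
  have hbest := hS.value_continues hU hj hj5 hl hi.le
  constructor
  · intro hc
    by_contra hns
    have hg : (10000000 : ℝ) - approx j l k + 180 < approx j k l := by exact_mod_cast hgap.2 hns
    have := hbest true
    rw [hc] at this
    linarith [h1.1, h2.2]
  · intro hs
    have hg : (approx j k l : ℝ) + 180 < 10000000 - approx j l k := by exact_mod_cast hgap.1 hs
    by_contra hc
    have := hbest false
    rw [Bool.not_eq_false] at hc
    rw [hc] at this
    linarith [h1.2, h2.1]

end SuperSix

theorem mainTheorem6 :
    ((∃ S : SuperSix.Strategy, SuperSix.IsOptimal 13 S) ∧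
      ∀ S : SuperSix.Strategy, SuperSix.IsOptimal 13 S →
        ∀ j k l : ℕ, 1 ≤ j → j ≤ 5 → 1 ≤ k → 1 ≤ l → j + k + l = 13 →
          (S.continues j k l = false ↔
            j = 4 ∨ j = 5 ∨ (j = 3 ∧ k ∈ ({4, 5, 6} : Finset ℕ)))) ∧
    ((∃ S : SuperSix.Strategy, SuperSix.IsOptimal 14 S) ∧
      ∀ S : SuperSix.Strategy, SuperSix.IsOptimal 14 S →
        ∀ j k l : ℕ, 1 ≤ j → j ≤ 5 → 1 ≤ k → 1 ≤ l → j + k + l = 14 →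
          (S.continues j k l = false ↔
            j = 4 ∨ j = 5 ∨ (j = 3 ∧ k ∈ ({3, 4, 5, 6, 7, 8} : Finset ℕ)))) ∧
    ((∃ S : SuperSix.Strategy, SuperSix.IsOptimal 15 S) ∧
      ∀ S : SuperSix.Strategy, SuperSix.IsOptimal 15 S →
        ∀ j k l : ℕ, 1 ≤ j → j ≤ 5 → 1 ≤ k → 1 ≤ l → j + k + l = 15 →
          (S.continues j k l = false ↔
            j = 4 ∨ j = 5 ∨ (j = 3 ∧ k ∈ ({3, 4, 5, 6, 7, 8, 9} : Finset ℕ)))) := by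
  obtain ⟨U, hU⟩ := SuperSix.exists_isValue
  refine ⟨⟨⟨_, SuperSix.greedy_isOptimal hU 13⟩, ?_⟩, ⟨⟨_, SuperSix.greedy_isOptimal hU 14⟩, ?_⟩,
    ⟨⟨_, SuperSix.greedy_isOptimal hU 15⟩, ?_⟩⟩ <;>
  · intro S hS j k l hj hj5 hk hl hi
    rw [hS.continues_eq_false_iff hj hj5 hk hl hi (by norm_num) (by norm_num), SuperSix.Stops]
    -- For `j = 3` the sum `k + l` is 10, 11 or 12, which turns the lower bounds on `k` and `l` into
    -- the listed ranges of `k`.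
    simp only [Finset.mem_insert, Finset.mem_singleton]
    omega
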